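/- **Setting.** Let $M\ge 0$ and $N\ge 1$ be integers and $0<\delta<1$. Let $\mathcal X=\mathcal X_1\times\dots\times\mathcal X_M$ be a product of $M$ measurable spaces (the data sources), $\mathcal Y$ a measurable space, and $\mathcal D$ a probability distribution on $\mathcal X\times\mathcal Y$. Let $\mathcal A\subseteq\mathbb R$, and let $\ell:\mathbb R\times\mathcal Y\to\mathbb R$ be a measurable loss such that, for each $y$, $\ell(\cdot,y)$ is convex on the convex set $\mathcal A$ with values in $[0,1]$ there. For each $m$ let $\mathcal H_m$ be a class of measurable base learners $f^m:\mathcal X_m\to\mathcal A$. Assume that the loss class $\ell\circ\mathcal H_m=\{(x,y)\mapsto\ell(f^m(x^{(m)}),y): f^m\in\mathcal H_m\}$ contains a countable subclass such that every member of $\ell\circ\mathcal H_m$ is the pointwise limit of a sequence from it (a measurability assumption). A weight vector is $W=(w^1,\dots,w^M)$ with measurable functions $w^m:\mathcal X\to[0,\infty)$ and $\sum_m w^m(x)=1$ for all $x$; the fusion model is $f(x)=\sum_{m=1}^M w^m(x)f^m(x^{(m)})$. Let $D_{\rm train}=((x_i,y_i))_{i=1}^N$ be an i.i.d. sample from $\mathcal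 D$. Write $\ell^m=\ell(f^m(x^{(m)}),y)$, $\hat E(f^m)=\frac1N\sum_{i=1}^N\ell(f^m(x_i^{(m)}),y_i)$ and $GError(f)=\mathbf E_{(x,y)\sim\mathcal D}[\ell(f(x),y)]$. For a class $\mathcal G$ of real functions on $\mathcal X\times\mathcal Y$ let $$\mathcal R_N(\mathcal G)=\mathbf E_{D_{\rm train}}\mathbf E_\sigma\Big[\sup_{g\in\mathcal G}\frac1N\sum_{i=1}^N\sigma_i\,g(x_i,y_i)\Big],$$ with $\sigma_1,\dots,\sigma_N$ independent and uniform on $\{-1,1\}$. Consider the inequality $$GError(f)\le\sum_{m=1}^M\mathbf E(w^m)\hat E(f^m)+\sum_{m=1}^M\mathbf E(w^m)\,\mathcal R_m+\sum_{m=1}^M\mathrm{Cov}(w^m,\ell^m)+M\sqrt{\frac{\ln(1/\delta)}{2N}},\qquad(\ast)$$ where $\mathbf E(w^m)$ and $\mathrm{Cov}$ are taken under $\mathcal D$. **Claim.** Let $\mathcal R_m=2\,\mathcal R_N(\ell\circ\mathcal H_m)$. Then: 1. for every weight vector $W$, with probability at least $1-\delta$ over $D_{\rm train}$, $(\ast)$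 holds simultaneously for all $f^1\in\mathcal H_1,\dots,f^M\in\mathcal H_M$; 2. if $\delta\le\frac12$, then with probability at least $1-\delta$ over $D_{\rm train}$, $(\ast)$ holds simultaneously for all weight vectors $W$ and all $f^1\in\mathcal H_1,\dots,f^M\in\mathcal H_M$. Moreover, suppose that all base learners take values in $\{-1,1\}$ and that their losses are zero-one losses, i.e. there are labels $\lambda(y)\in\{-1,1\}$ with $\ell(a,y)=\mathbf 1[a\ne\lambda(y)]$ for $a\in\{-1,1\}$ and all $y$. Then 1 and 2 also hold with $\mathcal R_m=\mathcal R_N(\mathcal H_m)$, the Rademacher complexity of the class of base learners itself (as functions $(x,y)\mapsto f^m(x^{(m)})$). -/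

import Mathlib

open MeasureTheory ProbabilityTheory Filter Topology

noncomputable section

namespace Fusion

/-- The value `1` or `-1` of a Rademacher sign. -/
def sign (b : Bool) : ℝ := if b then 1 else -1

/-- Empirical Rademacher complexity of a class `G` of real functions on the sample `S`:
the average over all `2 ^ N` sign vectors of `sup_{g ∈ G} (1 / N) ∑ i, σ i * g (S i)`. -/
def empRademacher {Z : Type*} {N : ℕ} (G : Set (Z → ℝ)) (S : Fin N → Z) : ℝ :=
  (∑ σ : Fin N → Bool, ⨆ g : G, (1 / (N : ℝ)) * ∑ i, sign (σ i) * g.1 (S i)) / 2 ^ N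

/-- Rademacher complexity: expectation of the empirical one over `N` i.i.d. points of law `D`. -/
def rademacher {Z : Type*} [MeasurableSpace Z] (D : Measure Z) (N : ℕ) (G : Set (Z → ℝ)) : ℝ :=
  ∫ S, empRademacher G S ∂(Measure.pi fun _ : Fin N => D)

/-- `G` has a countable subclass such that each member of `G` is the pointwise limit of a
sequence in the subclass (this makes suprema over `G` measurable). -/
def PointwiseSeparable {Z : Type*} (G : Set (Z → ℝ)) : Prop :=
  ∃ G₀ : Set (Z → ℝ), G₀ ⊆ G ∧ G₀.Countable ∧
    ∀ g ∈ G, ∃ u : ℕ → Z → ℝ, (∀ k, u k ∈ G₀) ∧ ∀ z, Tendsto (fun k => u k z) atTop (𝓝 (g z))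

/-- The assertion `E` holds with `P`-probability at least `p`
(on some measurable set of that measure, so that `E` itself need not be measurable). -/
def HoldsWithProb {Ω : Type*} [MeasurableSpace Ω] (P : Measure Ω) (p : ℝ) (E : Ω → Prop) : Prop :=
  ∃ A : Set Ω, MeasurableSet A ∧ ENNReal.ofReal p ≤ P A ∧ ∀ ω ∈ A, E ω

section Model

variable {M : ℕ} {X : Fin M → Type*} {Y : Type*}

/-- Weights `w m`, functions of the whole multi-source input, forming a convex combination. -/
def IsWeights [∀ m, MeasurableSpace (X m)] (w : Fin M → (∀ m, X m) → ℝ) : Prop :=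
  (∀ m, Measurable (w m)) ∧ (∀ m x, 0 ≤ w m x) ∧ ∀ x, ∑ m, w m x = 1

/-- The parallel fusion model `x ↦ ∑ m, w m x * f m (x m)`. -/
def fused (w : Fin M → (∀ m, X m) → ℝ) (f : ∀ m, X m → ℝ) (x : ∀ m, X m) : ℝ :=
  ∑ m, w m x * f m (x m)

/-- The loss `ℓ (g (x m), y)` of a base learner `g` on source `m`, as a function of `(x, y)`. -/
def baseLoss (ℓ : ℝ → Y → ℝ) (m : Fin M) (g : X m → ℝ) (z : (∀ m, X m) × Y) : ℝ :=
  ℓ (g (z.1 m)) z.2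

/-- The loss class `ℓ ∘ H` of a class `H` of base learners on source `m`. -/
def lossClass (ℓ : ℝ → Y → ℝ) (m : Fin M) (H : Set (X m → ℝ)) : Set ((∀ m, X m) × Y → ℝ) :=
  baseLoss ℓ m '' H

/-- The class `H` of base learners on source `m` itself, as functions of `(x, y)`. -/
def learnerClass (Y : Type*) (m : Fin M) (H : Set (X m → ℝ)) : Set ((∀ m, X m) × Y → ℝ) :=
  (fun g z => g (z.1 m)) '' H

/-- Empirical error of the base learner `g` on the training set `S`. -/
def empError {N : ℕ} (ℓ : ℝ → Y → ℝ) (m : Fin M) (g : X m → ℝ)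
    (S : Fin N → (∀ m, X m) × Y) : ℝ :=
  (1 / (N : ℝ)) * ∑ i, baseLoss ℓ m g (S i)

variable [∀ m, MeasurableSpace (X m)] [MeasurableSpace Y]

/-- Generalization error of the fusion model. -/
def genError (D : Measure ((∀ m, X m) × Y)) (ℓ : ℝ → Y → ℝ)
    (w : Fin M → (∀ m, X m) → ℝ) (f : ∀ m, X m → ℝ) : ℝ :=
  ∫ z, ℓ (fused w f z.1) z.2 ∂D

/-- The bound: average empirical loss, average complexity (`R m` being the complexity attached
to source `m`), covariance, and confidence term. -/
def fusionBound {N : ℕ} (D : Measure ((∀ m, X m) × Y)) (ℓ : ℝ → Y → ℝ) (R : Fin M → ℝ) (δ : ℝ)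
    (w : Fin M → (∀ m, X m) → ℝ) (f : ∀ m, X m → ℝ) (S : Fin N → (∀ m, X m) × Y) : ℝ :=
  ∑ m, (∫ z, w m z.1 ∂D) * empError ℓ m (f m) S
    + ∑ m, (∫ z, w m z.1 ∂D) * R m
    + ∑ m, covariance (fun z => w m z.1) (baseLoss ℓ m (f m)) D
    + M * √(Real.log (1 / δ) / (2 * N))

end Model

end Fusion

end

noncomputable section

namespace Fusion

/-! By Jensen's inequality, applied pointwise to the convex combination with weights `w m x`, the
error of the fusion model is at most `∑ E(w m * ℓ m)`, which equals `∑ E(w m) E(ℓ m) + ∑ Cov(w m, ℓ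
m)` (`genError_le`). It remains to compare each `E(ℓ m)` with its empirical mean, uniformly over the
class of source `m`. The worst gap `Φ m` has bounded differences `1 / N`, and symmetrization with a
ghost sample bounds its mean by twice the Rademacher complexity of the loss class
(`PointwiseSeparable.exists_deviation_bound`).

For fixed weights the numbers `p m = E(w m)` form a deterministic probability vector, so `∑ p m * Φ
m` again has bounded differences `1 / N`. One application of McDiarmid's inequality costs a single
confidence term `ε = √(ln(1/δ) / (2N))`, and `ε ≤ M ε`.

Uniformly in the weights, each `Φ m` is allowed to exceed its mean by `M ε`. This fails with
probability at most `δ ^ M ^ 2` per source, and the union bound gives `M * δ ^ M ^ 2 ≤ δ` when `δ ≤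
1 / 2`. The good event does not mention the weights.

For labels `λ = ±1` the zero-one loss of `a = ±1` is `(1 - a λ) / 2`. A change of signs then turns
twice the complexity of the loss class into that of the learners. -/

/-! ### Concentration: from Hoeffding's lemma to McDiarmid's inequality. -/

lemma integrable_of_abs_le {Ω : Type*} [MeasurableSpace Ω] {P : Measure Ω} [IsFiniteMeasure P]
    {f : Ω → ℝ} {B : ℝ} (hf : Measurable f) (hB : ∀ ω, |f ω| ≤ B) : Integrable f P :=
  Integrable.of_bound hf.aestronglyMeasurable B (Eventually.of_forall hB)

lemma abs_integral_le_of_abs_le {Ω : Type*} [MeasurableSpace Ω] {P : Measure Ω}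
    [IsProbabilityMeasure P] {f : Ω → ℝ} {B : ℝ} (hB : ∀ ω, |f ω| ≤ B) : |∫ ω, f ω ∂P| ≤ B := by
  simpa using norm_integral_le_of_norm_le_const (μ := P) (f := f) (C := B) (Eventually.of_forall hB)

/-- **Hoeffding's lemma** for a bounded function of oscillation at most `c`. -/
lemma integral_exp_le_of_oscillation_le {Z : Type*} [MeasurableSpace Z] (D : Measure Z)
    [IsProbabilityMeasure D] {f : Z → ℝ} {B c : ℝ} (hf : Measurable f) (hB : ∀ z, |f z| ≤ B)
    (hc : ∀ z z', |f z - f z'| ≤ c) (t : ℝ) :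
    ∫ z, Real.exp (t * f z) ∂D ≤ Real.exp (t * ∫ z, f z ∂D + c ^ 2 * t ^ 2 / 8) := by
  have hne : Nonempty Z := D.nonempty_of_neZero
  have hbdd : BddBelow (Set.range f) := ⟨-B, by rintro _ ⟨z, rfl⟩; exact (abs_le.1 (hB z)).1⟩
  -- Oscillation at most `c` places `f` in an interval of length `c` starting at its infimum, hence
  -- the variance proxy `(c / 2) ^ 2`.
  have hI : ∀ z, f z ∈ Set.Icc (⨅ z, f z) ((⨅ z, f z) + c) := fun z =>
    ⟨ciInf_le hbdd z, by
      have : f z - c ≤ ⨅ z, f z := le_ciInf fun z' => by linarith [(abs_le.1 (hc z z')).2]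
      linarith⟩
  have h := (hasSubgaussianMGF_of_mem_Icc (μ := D) hf.aemeasurable (Eventually.of_forall hI)).mgf_le t
  have hmgf : mgf (fun z => f z - ∫ z, f z ∂D) D t
      = (∫ z, Real.exp (t * f z) ∂D) * Real.exp (-(t * ∫ z, f z ∂D)) := by
    rw [mgf, ← integral_mul_const]
    refine integral_congr_ae (Eventually.of_forall fun z => ?_)
    simp only [← Real.exp_add]
    ring_nf
  rw [hmgf, Real.exp_neg, ← div_eq_mul_inv, div_le_iff₀ (Real.exp_pos _), ← Real.exp_add] at h
  refine h.trans_eq ?_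
  congr 1
  simp [div_pow]
  ring

/-- Exponential moments of a function of independent variables with bounded differences. -/
lemma integral_exp_le_of_bounded_differences {Z : Type*} [MeasurableSpace Z] (D : Measure Z)
    [IsProbabilityMeasure D] {B c : ℝ} (N : ℕ) (f : (Fin N → Z) → ℝ) (hf : Measurable f)
    (hB : ∀ S, |f S| ≤ B)
    (hc : ∀ (i : Fin N) (S S' : Fin N → Z), (∀ j, j ≠ i → S j = S' j) → |f S - f S'| ≤ c)
    (t : ℝ) :
    ∫ S, Real.exp (t * f S) ∂(Measure.pi fun _ => D)
      ≤ Real.exp (t * ∫ S, f S ∂(Measure.pi fun _ => D) + N * (c ^ 2 * t ^ 2 / 8)) := by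
  induction N with
  | zero =>
    have h : ∀ S, f S = f (fun i => i.elim0) := fun S => congrArg f (Subsingleton.elim _ _)
    simp only [h]
    simp
  | succ n ih =>
    have hmp := (measurePreserving_piFinSuccAbove (fun _ : Fin (n + 1) => D) 0).symm
    set e := (MeasurableEquiv.piFinSuccAbove (fun _ : Fin (n + 1) => Z) 0).symm with he
    have hes : ∀ z S, e (z, S) = Fin.cons z S := fun z S => by
      simp [he, MeasurableEquiv.piFinSuccAbove, Fin.insertNthEquiv]
    have hfe : Measurable fun p => f (e p) := hf.comp e.measurable
    have hcons : ∀ S, Measurable fun z => f (e (z, S)) := fun S =>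
      hfe.comp (measurable_id.prodMk measurable_const)
    have hexp : Measurable fun p => Real.exp (t * f (e p)) := (hfe.const_mul t).exp
    have hexpB : ∀ p, |Real.exp (t * f (e p))| ≤ Real.exp (|t| * B) := fun p => by
      rw [Real.abs_exp]
      refine Real.exp_le_exp.2 ((le_abs_self _).trans ?_)
      rw [abs_mul]
      exact mul_le_mul_of_nonneg_left (hB _) (abs_nonneg t)
    -- Averaging out the first coordinate keeps the bound and the bounded differences, so induction
    -- applies to `g`; Hoeffding's lemma in the removed coordinate costs one factor `exp (c ^ 2 * t
    -- ^ 2 / 8)`.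
    let g : (Fin n → Z) → ℝ := fun S => ∫ z, f (e (z, S)) ∂D
    have hg : Measurable g := hfe.stronglyMeasurable.integral_prod_left'.measurable
    have hgB : ∀ S, |g S| ≤ B := fun S => abs_integral_le_of_abs_le fun z => hB _
    have hi : ∀ S, Integrable (fun z => f (e (z, S))) D := fun S =>
      integrable_of_abs_le (hcons S) fun z => hB _
    have hgc : ∀ (i : Fin n) (S S' : Fin n → Z), (∀ j, j ≠ i → S j = S' j) →
        |g S - g S'| ≤ c := fun i S S' h => by
      simp only [g]
      rw [← integral_sub (hi S) (hi S')]
      refine abs_integral_le_of_abs_le fun z => hc i.succ _ _ fun j => ?_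
      rw [hes, hes]
      refine Fin.cases (fun _ => rfl) (fun j hj => ?_) j
      exact h j fun hji => hj (by rw [hji])
    rw [← hmp.integral_comp' (g := fun S => Real.exp (t * f S)), ← hmp.integral_comp' (g := f)]
    rw [integral_prod_symm _ (integrable_of_abs_le hexp hexpB),
      integral_prod_symm _ (integrable_of_abs_le hfe fun p => hB _)]
    calc
      _ ≤ ∫ S, Real.exp (t * g S) * Real.exp (c ^ 2 * t ^ 2 / 8) ∂(Measure.pi fun _ => D) := by
        refine integral_mono ?_ ?_ fun S => ?_
        · exact (integrable_of_abs_le hexp hexpB).integral_prod_right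
        · refine Integrable.mul_const (integrable_of_abs_le (B := Real.exp (|t| * B))
            (hg.const_mul t).exp fun S => ?_) _
          rw [Real.abs_exp]
          refine Real.exp_le_exp.2 ((le_abs_self _).trans ?_)
          rw [abs_mul]
          exact mul_le_mul_of_nonneg_left (hgB _) (abs_nonneg t)
        · simp only [← Real.exp_add]
          refine integral_exp_le_of_oscillation_le D (hcons S) (fun z => hB _) (fun z z' => ?_) t
          refine hc 0 _ _ fun j hj => ?_
          rw [hes, hes]
          obtain ⟨k, rfl⟩ := Fin.exists_succ_eq_of_ne_zero hj
          rfl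
      _ ≤ _ := by
        rw [integral_mul_const]
        refine (mul_le_mul_of_nonneg_right (ih g hg hgB hgc) (Real.exp_pos _).le).trans_eq ?_
        rw [← Real.exp_add]
        congr 1
        simp only [g]
        push_cast
        ring

/-- **McDiarmid's inequality** for differences bounded by `1 / N`. -/
lemma measureReal_add_le_of_bounded_differences {Z : Type*} [MeasurableSpace Z] (D : Measure Z)
    [IsProbabilityMeasure D] {B : ℝ} {N : ℕ} (hN : 0 < N) (f : (Fin N → Z) → ℝ)
    (hf : Measurable f) (hB : ∀ S, |f S| ≤ B)
    (hc : ∀ (i : Fin N) (S S' : Fin N → Z), (∀ j, j ≠ i → S j = S' j) →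
      |f S - f S'| ≤ 1 / (N : ℝ)) {ε : ℝ} (hε : 0 ≤ ε) :
    (Measure.pi fun _ : Fin N => D).real {S | ∫ S, f S ∂(Measure.pi fun _ => D) + ε ≤ f S}
      ≤ Real.exp (-(2 * N * ε ^ 2)) := by
  set P := Measure.pi fun _ : Fin N => D
  have hNR : (0 : ℝ) < N := by exact_mod_cast hN
  -- The Chernoff exponent `-t ε + t ^ 2 / (8 N)` is minimal at `t = 4 N ε`, with value `-2 N ε ^
  -- 2`.
  have ht : 0 ≤ 4 * N * ε := by positivity
  have hint : Integrable (fun S => Real.exp (4 * N * ε * f S)) P := by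
    refine integrable_of_abs_le (B := Real.exp (4 * N * ε * B)) (hf.const_mul _).exp fun S => ?_
    rw [Real.abs_exp]
    exact Real.exp_le_exp.2 (mul_le_mul_of_nonneg_left ((le_abs_self _).trans (hB S)) ht)
  refine (measure_ge_le_exp_mul_mgf (X := f) _ ht hint).trans ?_
  refine (mul_le_mul_of_nonneg_left
    (integral_exp_le_of_bounded_differences D N f hf hB hc (4 * N * ε)) (Real.exp_pos _).le).trans_eq ?_
  rw [← Real.exp_add]
  congr 1
  field_simp
  ring

/-! ### Bounds for suprema, averages and signs. -/

lemma abs_ciSup_le {ι : Type*} [Nonempty ι] {a : ι → ℝ} {B : ℝ} (h : ∀ i, |a i| ≤ B) :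
    |⨆ i, a i| ≤ B := by
  have hb : BddAbove (Set.range a) := ⟨B, by rintro _ ⟨i, rfl⟩; exact (abs_le.1 (h i)).2⟩
  obtain ⟨i⟩ := ‹Nonempty ι›
  exact abs_le.2 ⟨(abs_le.1 (h i)).1.trans (le_ciSup hb i), ciSup_le fun i => (abs_le.1 (h i)).2⟩

lemma bddAbove_of_abs_le {ι : Type*} {a : ι → ℝ} {B : ℝ} (h : ∀ i, |a i| ≤ B) :
    BddAbove (Set.range a) :=
  ⟨B, by rintro _ ⟨i, rfl⟩; exact (abs_le.1 (h i)).2⟩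

lemma abs_ciSup_sub_ciSup_le {ι : Type*} [Nonempty ι] {a b : ι → ℝ} {c : ℝ}
    (ha : BddAbove (Set.range a)) (hb : BddAbove (Set.range b)) (h : ∀ i, |a i - b i| ≤ c) :
    |(⨆ i, a i) - ⨆ i, b i| ≤ c := by
  refine abs_sub_le_iff.2 ⟨?_, ?_⟩
  · rw [sub_le_iff_le_add]
    exact ciSup_le fun i => by linarith [(abs_le.1 (h i)).2, le_ciSup hb i]
  · rw [sub_le_iff_le_add]
    exact ciSup_le fun i => by linarith [(abs_le.1 (h i)).1, le_ciSup ha i]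

lemma abs_average_le {N : ℕ} {a : Fin N → ℝ} {B : ℝ} (hB : 0 ≤ B) (h : ∀ j, |a j| ≤ B) :
    |(1 / (N : ℝ)) * ∑ j, a j| ≤ B := by
  -- For `N = 0` the average is `0`, which is where `0 ≤ B` is needed.
  rcases Nat.eq_zero_or_pos N with rfl | hN
  · simpa using hB
  have hNR : (0 : ℝ) < N := by exact_mod_cast hN
  rw [abs_mul, abs_of_pos (by positivity : 0 < 1 / (N : ℝ)), one_div, inv_mul_le_iff₀ hNR]
  refine (Finset.abs_sum_le_sum_abs _ _).trans ((Finset.sum_le_sum fun j _ => h j).trans_eq ?_)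
  simp

lemma abs_sign (b : Bool) : |sign b| = 1 := by cases b <;> simp [sign]

lemma sign_not (b : Bool) : sign (!b) = -sign b := by cases b <;> simp [sign]

section Bounds

variable {Z ι : Type*} {N : ℕ}

/-- The supremum over a family of the correlation with a fixed sign vector. -/
def signedSup (g : ι → Z → ℝ) (σ : Fin N → Bool) (S : Fin N → Z) : ℝ :=
  ⨆ i, (1 / (N : ℝ)) * ∑ j, sign (σ j) * g i (S j)

/-- The largest gap between the empirical means of two samples, arranged in pairs. -/
def ghostSup (g : ι → Z → ℝ) (T : Fin N → Z × Z) : ℝ :=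
  ⨆ i, (1 / (N : ℝ)) * ∑ j, (g i (T j).2 - g i (T j).1)

variable {g : ι → Z → ℝ}

lemma abs_signed_le (hg01 : ∀ i z, g i z ∈ Set.Icc (0 : ℝ) 1) (σ : Fin N → Bool)
    (S : Fin N → Z) (i : ι) : |(1 / (N : ℝ)) * ∑ j, sign (σ j) * g i (S j)| ≤ 1 :=
  abs_average_le zero_le_one fun j => by
    rw [abs_mul, abs_sign, one_mul]
    exact abs_le.2 ⟨by linarith [(hg01 i (S j)).1], (hg01 i (S j)).2⟩

lemma abs_ghost_le (hg01 : ∀ i z, g i z ∈ Set.Icc (0 : ℝ) 1) (T : Fin N → Z × Z) (i : ι) :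
    |(1 / (N : ℝ)) * ∑ j, (g i (T j).2 - g i (T j).1)| ≤ 1 :=
  abs_average_le zero_le_one fun j => abs_le.2 ⟨
    by linarith [(hg01 i (T j).1).2, (hg01 i (T j).2).1],
    by linarith [(hg01 i (T j).1).1, (hg01 i (T j).2).2]⟩

lemma abs_signedSup_le [Nonempty ι] (hg01 : ∀ i z, g i z ∈ Set.Icc (0 : ℝ) 1) (σ : Fin N → Bool)
    (S : Fin N → Z) : |signedSup g σ S| ≤ 1 :=
  abs_ciSup_le (abs_signed_le hg01 σ S)

end Bounds

/-! ### Symmetrization over countable families. -/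

section Countable

variable {Z : Type*} [MeasurableSpace Z] {ι : Type*}

/-- The largest gap between expectation and empirical mean over a family of functions. -/
def supDeviation (D : Measure Z) {N : ℕ} (g : ι → Z → ℝ) (S : Fin N → Z) : ℝ :=
  ⨆ i, (∫ z, g i z ∂D - (1 / (N : ℝ)) * ∑ j, g i (S j))

variable {D : Measure Z} {N : ℕ} {g : ι → Z → ℝ}

lemma abs_deviation_le [IsProbabilityMeasure D] (hg01 : ∀ i z, g i z ∈ Set.Icc (0 : ℝ) 1) (S : Fin N → Z) (i : ι) :
    |∫ z, g i z ∂D - (1 / (N : ℝ)) * ∑ j, g i (S j)| ≤ 2 := by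
  have h1 : ∀ z, |g i z| ≤ 1 := fun z =>
    abs_le.2 ⟨by linarith [(hg01 i z).1], (hg01 i z).2⟩
  have h2 := abs_integral_le_of_abs_le (P := D) h1
  have h3 := abs_average_le (N := N) zero_le_one fun j => h1 (S j)
  exact (abs_sub _ _).trans (by linarith)

lemma measurable_supDeviation [Countable ι] (hg : ∀ i, Measurable (g i)) :
    Measurable (supDeviation (N := N) D g) :=
  Measurable.iSup fun i => measurable_const.sub <| (Finset.measurable_sum _ fun j _ =>
    (hg i).comp (measurable_pi_apply j)).const_mul _

lemma measurable_signedSup [Countable ι] (hg : ∀ i, Measurable (g i)) (σ : Fin N → Bool) :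
    Measurable (signedSup g σ) :=
  Measurable.iSup fun i => (Finset.measurable_sum _ fun j _ =>
    ((hg i).comp (measurable_pi_apply j)).const_mul _).const_mul _

lemma measurable_ghostSup [Countable ι] (hg : ∀ i, Measurable (g i)) :
    Measurable (ghostSup (N := N) g) :=
  Measurable.iSup fun i => (Finset.measurable_sum _ fun j _ =>
    ((hg i).comp (measurable_snd.comp (measurable_pi_apply j))).sub
      ((hg i).comp (measurable_fst.comp (measurable_pi_apply j)))).const_mul _

variable [Nonempty ι] [IsProbabilityMeasure D]

lemma abs_supDeviation_le (hg01 : ∀ i z, g i z ∈ Set.Icc (0 : ℝ) 1) (S : Fin N → Z) :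
    |supDeviation D g S| ≤ 2 :=
  abs_ciSup_le (abs_deviation_le hg01 S)

/-- Replacing one sample point alters a single summand, with values in `[0, 1]`, and a supremum
moves no more than its members do. -/
lemma supDeviation_bounded_differences (hg01 : ∀ i z, g i z ∈ Set.Icc (0 : ℝ) 1) (k : Fin N)
    (S S' : Fin N → Z) (h : ∀ j, j ≠ k → S j = S' j) :
    |supDeviation D g S - supDeviation D g S'| ≤ 1 / (N : ℝ) := by
  refine abs_ciSup_sub_ciSup_le (bddAbove_of_abs_le (abs_deviation_le hg01 S))
    (bddAbove_of_abs_le (abs_deviation_le hg01 S')) fun i => ?_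
  rw [sub_sub_sub_cancel_left, ← mul_sub, ← Finset.sum_sub_distrib,
    Finset.sum_eq_single k (fun j _ hj => by rw [h j hj, sub_self]) (by simp), abs_mul,
    abs_of_nonneg (by positivity : 0 ≤ 1 / (N : ℝ))]
  refine mul_le_of_le_one_right (by positivity) (abs_le.2 ⟨?_, ?_⟩) <;>
    linarith [(hg01 i (S k)).1, (hg01 i (S k)).2, (hg01 i (S' k)).1, (hg01 i (S' k)).2]

/-- The expectation of `g i` is the mean of its empirical average over an independent ghost sample,
the second components of `T`. A supremum of integrals is at most the integral of the supremum. -/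
lemma integral_supDeviation_le_integral_ghostSup [Countable ι] (hN : 0 < N)
    (hg : ∀ i, Measurable (g i)) (hg01 : ∀ i z, g i z ∈ Set.Icc (0 : ℝ) 1) :
    ∫ S, supDeviation D g S ∂(Measure.pi fun _ : Fin N => D)
      ≤ ∫ T, ghostSup g T ∂(Measure.pi fun _ : Fin N => D.prod D) := by
  have hNR : (N : ℝ) ≠ 0 := by exact_mod_cast hN.ne'
  have hmp := (measurePreserving_arrowProdEquivProdArrow Z Z (Fin N) (fun _ => D)
    fun _ => D).symm
  set e := (MeasurableEquiv.arrowProdEquivProdArrow Z Z (Fin N)).symm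
  have hm : Measurable fun p => ghostSup g (e p) := (measurable_ghostSup hg).comp e.measurable
  have hb : ∀ p, |ghostSup g (e p)| ≤ 1 := fun p => abs_ciSup_le (abs_ghost_le hg01 _)
  have hi := integrable_of_abs_le (P := (Measure.pi fun _ : Fin N => D).prod
    (Measure.pi fun _ : Fin N => D)) hm hb
  rw [← hmp.integral_comp' (g := ghostSup g), integral_prod _ hi]
  refine integral_mono (integrable_of_abs_le (measurable_supDeviation hg)
    (abs_supDeviation_le hg01)) hi.integral_prod_left fun S => ciSup_le fun i => ?_
  have hgi : ∀ z, |g i z| ≤ 1 := fun z => abs_le.2 ⟨by linarith [(hg01 i z).1], (hg01 i z).2⟩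
  have hgI : ∀ j : Fin N, Integrable (fun S' : Fin N → Z => g i (S' j))
      (Measure.pi fun _ : Fin N => D) := fun j =>
    integrable_of_abs_le ((hg i).comp (measurable_pi_apply j)) fun _ => hgi _
  have hgE : ∀ j : Fin N, ∫ S' : Fin N → Z, g i (S' j) ∂(Measure.pi fun _ : Fin N => D)
      = ∫ z, g i z ∂D := fun j =>
    integral_comp_eval (μ := fun _ : Fin N => D) (hg i).aestronglyMeasurable
  have hd : Integrable (fun S' : Fin N → Z => (1 / (N : ℝ)) * ∑ j, (g i (S' j) - g i (S j)))
      (Measure.pi fun _ : Fin N => D) :=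
    (integrable_finsetSum _ fun j _ => (hgI j).sub (integrable_const _)).const_mul _
  calc
    _ = ∫ S' : Fin N → Z, (1 / (N : ℝ)) * ∑ j, (g i (S' j) - g i (S j))
        ∂(Measure.pi fun _ : Fin N => D) := by
      have hs : ∫ S' : Fin N → Z, ∑ j, (g i (S' j) - g i (S j)) ∂(Measure.pi fun _ : Fin N => D)
          = ∑ j, ∫ S' : Fin N → Z, (g i (S' j) - g i (S j)) ∂(Measure.pi fun _ : Fin N => D) :=
        integral_finsetSum _ fun j _ => (hgI j).sub (integrable_const _)
      rw [integral_const_mul, hs]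
      simp_rw [integral_sub (hgI _) (integrable_const _), hgE]
      simp [Finset.sum_sub_distrib, mul_sub, hNR]
    _ ≤ _ := integral_mono hd (integrable_of_abs_le
        (hm.comp (measurable_const.prodMk measurable_id)) fun S' => hb (S, S')) fun S' =>
      le_ciSup (bddAbove_of_abs_le (abs_ghost_le hg01 (e (S, S')))) i

/-- Swapping the pairs with `σ j = false` preserves the joint law and multiplies the `j`-th gap by
`sign (σ j)`. The supremum of the signed gap splits by subadditivity; the subtracted half carries
the opposite signs. -/
lemma integral_ghostSup_le [Countable ι] (hg : ∀ i, Measurable (g i))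
    (hg01 : ∀ i z, g i z ∈ Set.Icc (0 : ℝ) 1) (σ : Fin N → Bool) :
    ∫ T, ghostSup g T ∂(Measure.pi fun _ : Fin N => D.prod D)
      ≤ ∫ S, signedSup g σ S ∂(Measure.pi fun _ : Fin N => D)
        + ∫ S, signedSup g (fun j => !σ j) S ∂(Measure.pi fun _ : Fin N => D) := by
  have hswap : MeasurePreserving (fun (T : Fin N → Z × Z) j => (if σ j then id else Prod.swap) (T j))
      (Measure.pi fun _ : Fin N => D.prod D) (Measure.pi fun _ : Fin N => D.prod D) := by
    refine measurePreserving_pi (f := fun j => if σ j then id else Prod.swap) _ _ fun j => ?_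
    cases σ j
    · exact Measure.measurePreserving_swap
    · exact MeasurePreserving.id _
  have hfst : MeasurePreserving (fun (T : Fin N → Z × Z) j => (T j).1)
      (Measure.pi fun _ : Fin N => D.prod D) (Measure.pi fun _ : Fin N => D) :=
    measurePreserving_pi (f := fun _ => Prod.fst) _ _ fun j => measurePreserving_fst
  have hsnd : MeasurePreserving (fun (T : Fin N → Z × Z) j => (T j).2)
      (Measure.pi fun _ : Fin N => D.prod D) (Measure.pi fun _ : Fin N => D) :=
    measurePreserving_pi (f := fun _ => Prod.snd) _ _ fun j => measurePreserving_snd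
  have hm := measurable_ghostSup (N := N) hg
  have hms := fun σ : Fin N → Bool => measurable_signedSup hg σ
  have hi1 : Integrable (fun T : Fin N → Z × Z => signedSup g σ fun j => (T j).2)
      (Measure.pi fun _ : Fin N => D.prod D) :=
    integrable_of_abs_le ((hms _).comp hsnd.measurable) fun T => abs_signedSup_le hg01 _ _
  have hi2 : Integrable (fun T : Fin N → Z × Z => signedSup g (fun j => !σ j) fun j => (T j).1)
      (Measure.pi fun _ : Fin N => D.prod D) :=
    integrable_of_abs_le ((hms _).comp hfst.measurable) fun T => abs_signedSup_le hg01 _ _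
  rw [← hswap.map_eq, integral_map hswap.measurable.aemeasurable hm.aestronglyMeasurable,
    ← hsnd.map_eq, integral_map hsnd.measurable.aemeasurable (hms _).aestronglyMeasurable,
    hsnd.map_eq, ← hfst.map_eq, integral_map hfst.measurable.aemeasurable
      (hms _).aestronglyMeasurable, ← integral_add hi1 hi2]
  refine integral_mono (integrable_of_abs_le (hm.comp hswap.measurable) fun T =>
    abs_ciSup_le (abs_ghost_le hg01 _)) (hi1.add hi2) fun T => ciSup_le fun i => ?_
  refine le_trans (le_of_eq ?_) (add_le_add
    (le_ciSup (bddAbove_of_abs_le (abs_signed_le hg01 σ fun j => (T j).2)) i)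
    (le_ciSup (bddAbove_of_abs_le (abs_signed_le hg01 (fun j => !σ j) fun j => (T j).1)) i))
  rw [← mul_add, ← Finset.sum_add_distrib]
  congr 1
  refine Finset.sum_congr rfl fun j _ => ?_
  rw [sign_not]
  cases hσ : σ j <;> simp [sign, hσ] <;> ring

/-- **Symmetrization**: the expected largest deviation is at most twice the Rademacher
complexity. -/
lemma integral_supDeviation_le [Countable ι] (hN : 0 < N) (hg : ∀ i, Measurable (g i))
    (hg01 : ∀ i z, g i z ∈ Set.Icc (0 : ℝ) 1) :
    ∫ S, supDeviation D g S ∂(Measure.pi fun _ : Fin N => D)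
      ≤ 2 * ∫ S, (∑ σ : Fin N → Bool, signedSup g σ S) / 2 ^ N
          ∂(Measure.pi fun _ : Fin N => D) := by
  refine (integral_supDeviation_le_integral_ghostSup hN hg hg01).trans ?_
  rw [integral_div, integral_finsetSum _ fun σ _ =>
    integrable_of_abs_le (measurable_signedSup hg σ) (abs_signedSup_le hg01 σ)]
  have hflip : ∑ σ : Fin N → Bool, ∫ S, signedSup g (fun j => !σ j) S
        ∂(Measure.pi fun _ : Fin N => D)
      = ∑ σ : Fin N → Bool, ∫ S, signedSup g σ S ∂(Measure.pi fun _ : Fin N => D) :=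
    Equiv.sum_comp (Equiv.piCongrRight fun _ : Fin N => Equiv.boolNot)
      fun σ => ∫ S, signedSup g σ S ∂(Measure.pi fun _ : Fin N => D)
  -- The previous bound holds for each of the `2 ^ N` sign vectors. Summed over all of them its two
  -- halves agree, whence the factor 2.
  have h := Finset.sum_le_sum fun (σ : Fin N → Bool) (_ : σ ∈ Finset.univ) =>
    integral_ghostSup_le (D := D) hg hg01 σ
  rw [Finset.sum_add_distrib, hflip] at h
  simp only [Finset.sum_const, Finset.card_univ, Fintype.card_pi, Fintype.card_bool,
    Finset.prod_const, Fintype.card_fin, nsmul_eq_mul, Nat.cast_pow, Nat.cast_ofNat] at h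
  rw [← mul_div_assoc, le_div_iff₀ (by positivity)]
  linarith

end Countable

/-! ### From countable to pointwise separable classes. -/

lemma le_ciSup_of_tendsto {ι : Type*} {a : ι → ℝ} (ha : BddAbove (Set.range a)) {u : ℕ → ι}
    {b : ℝ} (h : Tendsto (fun k => a (u k)) atTop (𝓝 b)) : b ≤ ⨆ i, a i :=
  le_of_tendsto' h fun k => le_ciSup ha (u k)

/-- Uniform deviations over a separable class of `[0, 1]`-valued functions are dominated by a
measurable function with bounded differences whose mean is at most twice the Rademacher
complexity. -/
lemma PointwiseSeparable.exists_deviation_bound {Z : Type*} [MeasurableSpace Z] {D : Measure Z}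
    [IsProbabilityMeasure D] {N : ℕ} (hN : 0 < N) {G : Set (Z → ℝ)} (hsep : PointwiseSeparable G)
    (hne : G.Nonempty) (hG : ∀ g ∈ G, Measurable g)
    (hG01 : ∀ g ∈ G, ∀ z, g z ∈ Set.Icc (0 : ℝ) 1) :
    ∃ Φ : (Fin N → Z) → ℝ, Measurable Φ ∧ (∀ S, |Φ S| ≤ 2) ∧
      (∀ (i : Fin N) (S S' : Fin N → Z), (∀ j, j ≠ i → S j = S' j) →
        |Φ S - Φ S'| ≤ 1 / (N : ℝ)) ∧
      ∫ S, Φ S ∂(Measure.pi fun _ => D) ≤ 2 * rademacher D N G ∧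
      ∀ g ∈ G, ∀ S, ∫ z, g z ∂D - (1 / (N : ℝ)) * ∑ j, g (S j) ≤ Φ S := by
  obtain ⟨G₀, hsub, hcount, hlim⟩ := hsep
  have hcountable : Countable G₀ := hcount.to_subtype
  have hne₀ : Nonempty G₀ := by
    obtain ⟨g, hg⟩ := hne
    obtain ⟨u, hu, -⟩ := hlim g hg
    exact ⟨⟨u 0, hu 0⟩⟩
  have hneG : Nonempty G := hne.to_subtype
  let γ : G₀ → Z → ℝ := fun g => g.1
  have hγ : ∀ g : G₀, Measurable (γ g) := fun g => hG _ (hsub g.2)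
  have hγ01 : ∀ (g : G₀) z, γ g z ∈ Set.Icc (0 : ℝ) 1 := fun g => hG01 _ (hsub g.2)
  refine ⟨supDeviation D γ, measurable_supDeviation hγ, abs_supDeviation_le hγ01,
    supDeviation_bounded_differences hγ01, ?_, fun g hg S => ?_⟩
  · refine (integral_supDeviation_le hN hγ hγ01).trans_eq ?_
    rw [rademacher]
    congr 2
    funext S
    rw [empRademacher]
    congr 1
    -- Signed averages depend on finitely many values, so pointwise limits do not enlarge the
    -- supremum: `G₀` and `G` have the same empirical complexity.
    refine Finset.sum_congr rfl fun σ _ => le_antisymm ?_ (ciSup_le fun g => ?_)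
    · refine ciSup_le fun g => ?_
      exact le_ciSup (f := fun g : G => (1 / (N : ℝ)) * ∑ j, sign (σ j) * g.1 (S j))
        (bddAbove_of_abs_le (abs_signed_le (g := fun g : G => g.1) (fun g => hG01 g g.2) σ S))
        ⟨g.1, hsub g.2⟩
    · obtain ⟨u, hu, hut⟩ := hlim g.1 g.2
      refine le_ciSup_of_tendsto (bddAbove_of_abs_le (abs_signed_le hγ01 σ S))
        (u := fun k => ⟨u k, hu k⟩) ?_
      exact (tendsto_finsetSum _ fun j _ => (hut (S j)).const_mul _).const_mul _
  · obtain ⟨u, hu, hut⟩ := hlim g hg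
    refine le_ciSup_of_tendsto (bddAbove_of_abs_le (abs_deviation_le hγ01 S))
      (u := fun k => ⟨u k, hu k⟩) ?_
    refine Tendsto.sub ?_ ((tendsto_finsetSum _ fun j _ => hut (S j)).const_mul _)
    -- Expectations also pass to the limit, the functions being dominated by 1.
    refine tendsto_integral_of_dominated_convergence (fun _ => (1 : ℝ))
      (fun k => (hG _ (hsub (hu k))).aestronglyMeasurable) (integrable_const _)
      (fun k => Eventually.of_forall fun z => ?_) (Eventually.of_forall hut)
    have := hG01 _ (hsub (hu k)) z
    exact abs_le.2 ⟨by linarith [this.1], this.2⟩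

lemma holdsWithProb_of_compl {Ω : Type*} [MeasurableSpace Ω] {P : Measure Ω}
    [IsProbabilityMeasure P] {δ : ℝ} {E : Ω → Prop} {C : Set Ω} (hC : MeasurableSet C)
    (hP : P.real C ≤ δ) (hE : ∀ ω ∉ C, E ω) : HoldsWithProb P (1 - δ) E := by
  refine ⟨Cᶜ, hC.compl, ?_, hE⟩
  rw [← ofReal_measureReal, probReal_compl_eq_one_sub hC]
  exact ENNReal.ofReal_le_ofReal (by linarith)

lemma iSup_image {α : Type*} {β : Type*} (φ : α → β) (H : Set α) (F : β → ℝ) :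
    ⨆ b : φ '' H, F b.1 = ⨆ a : H, F (φ a.1) :=
  (Function.Surjective.iSup_comp (f := fun a : H => (⟨φ a.1, a.1, a.2, rfl⟩ : φ '' H))
    (by rintro ⟨_, a, ha, rfl⟩; exact ⟨⟨a, ha⟩, rfl⟩) fun b => F b.1).symm

lemma sum_sum_sign (N : ℕ) : ∑ σ : Fin N → Bool, ∑ j, sign (σ j) = 0 := by
  have h := Equiv.sum_comp (Equiv.piCongrRight fun _ : Fin N => Equiv.boolNot)
    fun σ : Fin N → Bool => ∑ j, sign (σ j)
  have h' : ∑ σ : Fin N → Bool, ∑ j, sign (!σ j) = -∑ σ : Fin N → Bool, ∑ j, sign (σ j) := by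
    simp only [sign_not, Finset.sum_neg_distrib]
  have h'' := h'.symm.trans h
  linarith

/-! ### Zero-one losses, weights and the generalization bounds. -/

section Model

variable {M : ℕ} {X : Fin M → Type*} {Y : Type*}

/-- Since the loss is `(1 - a λ) / 2`, twice the signed average of the loss is the average of the
signs plus that of the learner with signs `-σ j * λ j`. The first term cancels over all `σ`, and for
a fixed sample the second only permutes the sign vectors. -/
lemma two_mul_empRademacher_lossClass {N : ℕ} {ℓ : ℝ → Y → ℝ} {label : Y → ℝ}
    (hlabel : ∀ y, label y = 1 ∨ label y = -1) {m : Fin M} {H : Set (X m → ℝ)}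
    (hne : H.Nonempty) (hH : ∀ g ∈ H, ∀ x, g x = 1 ∨ g x = -1)
    (hℓ : ∀ a y, a = 1 ∨ a = -1 → ℓ a y = if a = label y then 0 else 1)
    (S : Fin N → (∀ m, X m) × Y) :
    2 * empRademacher (lossClass ℓ m H) S = empRademacher (learnerClass Y m H) S := by
  have hneH : Nonempty H := hne.to_subtype
  -- Multiplication of the `j`-th sign by `-λ j`: a negation exactly where the label is 1.
  let flip : (Fin N → Bool) ≃ (Fin N → Bool) := Equiv.piCongrRight fun j =>
    if label (S j).2 = 1 then Equiv.boolNot else Equiv.refl Bool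
  have hflip : ∀ σ j, sign (flip σ j) = -(sign (σ j) * label (S j).2) := fun σ j => by
    rcases hlabel (S j).2 with h | h
    · simp [flip, h, sign_not]
    · have : ¬ ((-1 : ℝ) = 1) := by norm_num
      simp [flip, h, this]
  let c : (Fin N → Bool) → H → ℝ := fun σ g =>
    (1 / (N : ℝ)) * ∑ j, sign (σ j) * g.1 ((S j).1 m)
  have hc : ∀ σ g, |c σ g| ≤ 1 := fun σ g => abs_average_le zero_le_one fun j => by
    rcases hH g.1 g.2 ((S j).1 m) with h | h <;> simp [h, abs_sign]
  have hloss : ∀ σ : Fin N → Bool,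
      2 * (⨆ g : lossClass ℓ m H, (1 / (N : ℝ)) * ∑ j, sign (σ j) * g.1 (S j))
        = (1 / (N : ℝ)) * ∑ j, sign (σ j) + ⨆ g, c (flip σ) g := fun σ => by
    rw [lossClass, iSup_image (baseLoss ℓ m) H fun b => (1 / (N : ℝ)) * ∑ j, sign (σ j) * b (S j),
      Real.mul_iSup_of_nonneg zero_le_two, add_comm, ciSup_add (bddAbove_of_abs_le (hc _))]
    refine iSup_congr fun g => ?_
    simp only [c, hflip]
    rw [← mul_add, ← Finset.sum_add_distrib, mul_left_comm, Finset.mul_sum]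
    congr 1
    refine Finset.sum_congr rfl fun j _ => ?_
    rw [baseLoss, hℓ _ _ (hH g.1 g.2 _)]
    rcases hH g.1 g.2 ((S j).1 m) with h | h <;> rcases hlabel (S j).2 with h' | h' <;>
      norm_num [h, h'] <;> ring
  rw [empRademacher, empRademacher, ← mul_div_assoc, Finset.mul_sum]
  congr 1
  rw [Finset.sum_congr rfl fun σ _ => hloss σ, Finset.sum_add_distrib, ← Finset.mul_sum,
    sum_sum_sign, mul_zero, zero_add, Equiv.sum_comp flip fun σ => ⨆ g, c σ g]
  refine Finset.sum_congr rfl fun σ _ => ?_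
  rw [learnerClass, iSup_image (fun (g : X m → ℝ) (z : (∀ m, X m) × Y) => g (z.1 m)) H
    fun b => (1 / (N : ℝ)) * ∑ j, sign (σ j) * b (S j)]

variable [∀ m, MeasurableSpace (X m)] [MeasurableSpace Y]

lemma two_mul_rademacher_lossClass (D : Measure ((∀ m, X m) × Y)) (N : ℕ) {ℓ : ℝ → Y → ℝ}
    {label : Y → ℝ} (hlabel : ∀ y, label y = 1 ∨ label y = -1) {m : Fin M} {H : Set (X m → ℝ)}
    (hne : H.Nonempty) (hH : ∀ g ∈ H, ∀ x, g x = 1 ∨ g x = -1)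
    (hℓ : ∀ a y, a = 1 ∨ a = -1 → ℓ a y = if a = label y then 0 else 1) :
    2 * rademacher D N (lossClass ℓ m H) = rademacher D N (learnerClass Y m H) := by
  rw [rademacher, rademacher, ← integral_const_mul]
  simp only [two_mul_empRademacher_lossClass hlabel hne hH hℓ]

lemma measurable_baseLoss {ℓ : ℝ → Y → ℝ} (hℓ : Measurable (Function.uncurry ℓ)) (m : Fin M)
    {g : X m → ℝ} (hg : Measurable g) : Measurable (baseLoss ℓ m g) :=
  hℓ.comp ((hg.comp ((measurable_pi_apply m).comp measurable_fst)).prodMk measurable_snd)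

section Weights

variable {D : Measure ((∀ m, X m) × Y)} {w : Fin M → (∀ m, X m) → ℝ}

lemma IsWeights.integral_nonneg (hw : IsWeights w) (m : Fin M) : 0 ≤ ∫ z, w m z.1 ∂D :=
  MeasureTheory.integral_nonneg fun z => hw.2.1 m z.1

variable [IsProbabilityMeasure D]

lemma IsWeights.le_one (hw : IsWeights w) (m : Fin M) (x : ∀ m, X m) : w m x ≤ 1 :=
  hw.2.2 x ▸ Finset.single_le_sum (fun m _ => hw.2.1 m x) (Finset.mem_univ m)

lemma IsWeights.abs_le_one (hw : IsWeights w) (m : Fin M) (x : ∀ m, X m) : |w m x| ≤ 1 :=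
  abs_le.2 ⟨by linarith [hw.2.1 m x], hw.le_one m x⟩

lemma IsWeights.measurable_fst (hw : IsWeights w) (m : Fin M) :
    Measurable fun z : (∀ m, X m) × Y => w m z.1 :=
  (hw.1 m).comp _root_.measurable_fst

lemma IsWeights.integrable (hw : IsWeights w) (m : Fin M) : Integrable (fun z => w m z.1) D :=
  integrable_of_abs_le (hw.measurable_fst m) fun z => hw.abs_le_one m z.1

lemma IsWeights.sum_integral (hw : IsWeights w) : ∑ m, ∫ z, w m z.1 ∂D = 1 := by
  rw [← integral_finsetSum _ fun m _ => hw.integrable m]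
  simp [hw.2.2]

/-- Jensen's inequality splits the error of the fusion model into average base errors and
covariances. -/
lemma genError_le {A : Set ℝ} {ℓ : ℝ → Y → ℝ} (hℓ_meas : Measurable (Function.uncurry ℓ))
    (hℓ_convex : ∀ y, ConvexOn ℝ A (fun a => ℓ a y))
    (hℓ_range : ∀ a ∈ A, ∀ y, ℓ a y ∈ Set.Icc (0 : ℝ) 1) (hw : IsWeights w)
    {f : ∀ m, X m → ℝ} (hf : ∀ m, Measurable (f m)) (hfA : ∀ m x, f m x ∈ A) :
    genError D ℓ w f ≤ ∑ m, (∫ z, w m z.1 ∂D) * ∫ z, baseLoss ℓ m (f m) z ∂D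
      + ∑ m, covariance (fun z => w m z.1) (baseLoss ℓ m (f m)) D := by
  have habs : ∀ a ∈ A, ∀ y, |ℓ a y| ≤ 1 := fun a ha y =>
    abs_le.2 ⟨by linarith [(hℓ_range a ha y).1], (hℓ_range a ha y).2⟩
  -- Convexity of `A` keeps the fused prediction where the loss is bounded.
  have hfused : ∀ z : (∀ m, X m) × Y, fused w f z.1 ∈ A := fun z => by
    have := (hℓ_convex z.2).1.sum_mem (t := Finset.univ) (w := fun m => w m z.1)
      (z := fun m => f m (z.1 m)) (fun m _ => hw.2.1 m z.1) (hw.2.2 z.1) fun m _ => hfA m _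
    simpa [fused] using this
  have hfm : Measurable fun z : (∀ m, X m) × Y => fused w f z.1 :=
    Finset.measurable_sum _ fun m _ => (hw.measurable_fst m).mul
      ((hf m).comp ((measurable_pi_apply m).comp measurable_fst))
  have hlm := fun m => measurable_baseLoss hℓ_meas m (hf m)
  have hl1 : ∀ m z, |baseLoss ℓ m (f m) z| ≤ 1 := fun m z => habs _ (hfA m _) _
  have hprod : ∀ m, Integrable (fun z => w m z.1 * baseLoss ℓ m (f m) z) D := fun m =>
    integrable_of_abs_le (B := 1) ((hw.measurable_fst m).mul (hlm m)) fun z => by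
      rw [abs_mul]
      exact mul_le_one₀ (hw.abs_le_one m _) (abs_nonneg _) (hl1 m z)
  have hcov : ∀ m, covariance (fun z => w m z.1) (baseLoss ℓ m (f m)) D
      = ∫ z, w m z.1 * baseLoss ℓ m (f m) z ∂D
        - (∫ z, w m z.1 ∂D) * ∫ z, baseLoss ℓ m (f m) z ∂D := fun m =>
    covariance_eq_sub
      (MemLp.of_bound (hw.measurable_fst m).aestronglyMeasurable 1
        (Eventually.of_forall fun z => hw.abs_le_one m z.1))
      (MemLp.of_bound (hlm m).aestronglyMeasurable 1 (Eventually.of_forall (hl1 m)))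
  rw [← Finset.sum_add_distrib]
  -- The products of means cancel and leave `∑ E(w m * ℓ m)`, to be compared pointwise by Jensen.
  simp only [hcov, add_sub_cancel]
  rw [← integral_finsetSum _ fun m _ => hprod m]
  refine integral_mono (integrable_of_abs_le (hℓ_meas.comp (hfm.prodMk measurable_snd))
    fun z => habs _ (hfused z) _) (integrable_finsetSum _ fun m _ => hprod m) fun z => ?_
  have := (hℓ_convex z.2).map_sum_le (t := Finset.univ) (w := fun m => w m z.1)
    (p := fun m => f m (z.1 m)) (fun m _ => hw.2.1 m z.1) (hw.2.2 z.1) fun m _ => hfA m _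
  simpa [fused, baseLoss] using this

end Weights

/-- McDiarmid's tail at `k` confidence terms: `k = 1` serves fixed weights, `k = M` the union bound.
-/
lemma exp_neg_mul_sqrt_log {N : ℕ} (hN : 0 < N) {δ : ℝ} (hδ0 : 0 < δ) (hδ1 : δ < 1) (k : ℕ) :
    Real.exp (-(2 * N * (k * √(Real.log (1 / δ) / (2 * N))) ^ 2)) = δ ^ k ^ 2 := by
  have hNR : (0 : ℝ) < N := by exact_mod_cast hN
  have hlog : 0 ≤ Real.log (1 / δ) := Real.log_nonneg (by rw [le_div_iff₀ hδ0]; linarith)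
  rw [mul_pow, Real.sq_sqrt (by positivity), one_div, Real.log_inv]
  have : -(2 * (N : ℝ) * ((k : ℝ) ^ 2 * (-Real.log δ / (2 * N)))) = (k ^ 2 : ℕ) * Real.log δ := by
    push_cast
    field_simp
  rw [this, Real.exp_nat_mul, Real.exp_log hδ0]

/-- The union bound over sources. For `M = k + 1`, the factor `M ≤ 2 ^ k` is absorbed by `δ ^ k ≤ 2
^ (-k)`, which is where `δ ≤ 1 / 2` enters. -/
lemma nat_mul_pow_sq_le {δ : ℝ} (hδ0 : 0 < δ) (hδ : δ ≤ 1 / 2) (M : ℕ) :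
    (M : ℝ) * δ ^ M ^ 2 ≤ δ := by
  rcases M with _ | k
  · simpa using hδ0.le
  have h1 : δ ^ (k + 1) ^ 2 ≤ δ ^ k * δ := by
    rw [← pow_succ]
    exact pow_le_pow_of_le_one hδ0.le (by linarith) (by nlinarith)
  have h2 : δ ^ k ≤ (1 / 2) ^ k := pow_le_pow_left₀ hδ0.le hδ k
  have h3 : ((k + 1 : ℕ) : ℝ) ≤ 2 ^ k := by exact_mod_cast Nat.lt_two_pow_self
  have h4 : (2 : ℝ) ^ k * (1 / 2) ^ k = 1 := by rw [← mul_pow]; norm_num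
  calc
    _ ≤ ((2 : ℝ) ^ k) * ((1 / 2) ^ k * δ) :=
      mul_le_mul h3 (h1.trans (mul_le_mul_of_nonneg_right h2 hδ0.le)) (by positivity) (by positivity)
    _ = δ := by rw [← mul_assoc, h4, one_mul]

/-- Both generalization bounds, with any upper bounds `R m` on twice the Rademacher complexities
of the loss classes. -/
lemma holdsWithProb_genError_le (D : Measure ((∀ m, X m) × Y)) [IsProbabilityMeasure D]
    (A : Set ℝ) (ℓ : ℝ → Y → ℝ) (hℓ_meas : Measurable (Function.uncurry ℓ))
    (hℓ_convex : ∀ y, ConvexOn ℝ A (fun a => ℓ a y))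
    (hℓ_range : ∀ a ∈ A, ∀ y, ℓ a y ∈ Set.Icc (0 : ℝ) 1) (F : ∀ m, Set (X m → ℝ))
    (hF_meas : ∀ m, ∀ g ∈ F m, Measurable g) (hF_range : ∀ m, ∀ g ∈ F m, ∀ x, g x ∈ A)
    (hF_sep : ∀ m, PointwiseSeparable (lossClass ℓ m (F m)))
    {N : ℕ} (hN : 0 < N) {δ : ℝ} (hδ0 : 0 < δ) (hδ1 : δ < 1) (R : Fin M → ℝ)
    (hR : ∀ m, (F m).Nonempty → 2 * rademacher D N (lossClass ℓ m (F m)) ≤ R m) :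
    (∀ w, IsWeights w → HoldsWithProb (Measure.pi fun _ : Fin N => D) (1 - δ) fun S =>
        ∀ f, (∀ m, f m ∈ F m) → genError D ℓ w f ≤ fusionBound D ℓ R δ w f S) ∧
      (δ ≤ 1 / 2 → HoldsWithProb (Measure.pi fun _ : Fin N => D) (1 - δ) fun S =>
        ∀ w, IsWeights w → ∀ f, (∀ m, f m ∈ F m) →
          genError D ℓ w f ≤ fusionBound D ℓ R δ w f S) := by
  -- If some class is empty there is no tuple `f`, and both claims are vacuous.
  by_cases hne : ∀ m, (F m).Nonempty
  swap
  · push Not at hne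
    obtain ⟨m, hm⟩ := hne
    have hno : ∀ f : ∀ m, X m → ℝ, ¬ ∀ m, f m ∈ F m := fun f hf => by simpa [hm] using hf m
    exact ⟨fun w _ => holdsWithProb_of_compl MeasurableSet.empty (by simpa using hδ0.le)
        fun S _ f hf => (hno f hf).elim,
      fun _ => holdsWithProb_of_compl MeasurableSet.empty (by simpa using hδ0.le)
        fun S _ w _ f hf => (hno f hf).elim⟩
  choose Φ hΦm hΦb hΦd hΦR hΦ using fun m =>
    (hF_sep m).exists_deviation_bound (D := D) hN ((hne m).image _)
      (by rintro _ ⟨g, hg, rfl⟩; exact measurable_baseLoss hℓ_meas m (hF_meas m g hg))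
      (by rintro _ ⟨g, hg, rfl⟩ z; exact hℓ_range _ (hF_range m g hg _) _)
  set P := Measure.pi fun _ : Fin N => D
  set ε := √(Real.log (1 / δ) / (2 * N)) with hε
  have hε0 : 0 ≤ ε := Real.sqrt_nonneg _
  have hΦi : ∀ m, Integrable (Φ m) P := fun m => integrable_of_abs_le (hΦm m) (hΦb m)
  -- A deterministic reduction: only the weighted sum of the deviations `Φ m` has to be controlled
  -- on the sample.
  have key : ∀ w, IsWeights w → ∀ f, (∀ m, f m ∈ F m) → ∀ S,
      ∑ m, (∫ z, w m z.1 ∂D) * Φ m S ≤ ∑ m, (∫ z, w m z.1 ∂D) * R m + M * ε →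
      genError D ℓ w f ≤ fusionBound D ℓ R δ w f S := fun w hw f hf S hS => by
    have h1 := genError_le (D := D) hℓ_meas hℓ_convex hℓ_range hw
      (fun m => hF_meas m _ (hf m)) fun m => hF_range m _ (hf m)
    have h2 : ∑ m, (∫ z, w m z.1 ∂D) * ∫ z, baseLoss ℓ m (f m) z ∂D
        ≤ ∑ m, (∫ z, w m z.1 ∂D) * empError ℓ m (f m) S
          + ∑ m, (∫ z, w m z.1 ∂D) * Φ m S := by
      rw [← Finset.sum_add_distrib]
      refine Finset.sum_le_sum fun m _ => ?_
      rw [← mul_add]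
      refine mul_le_mul_of_nonneg_left ?_ (hw.integral_nonneg m)
      have := hΦ m _ ⟨f m, hf m, rfl⟩ S
      rw [empError]
      linarith
    rw [fusionBound]
    linarith
  have hmean : ∀ w, IsWeights w → ∑ m, (∫ z, w m z.1 ∂D) * ∫ S, Φ m S ∂P
      ≤ ∑ m, (∫ z, w m z.1 ∂D) * R m := fun w hw => Finset.sum_le_sum fun m _ =>
    mul_le_mul_of_nonneg_left ((hΦR m).trans (hR m (hne m))) (hw.integral_nonneg m)
  refine ⟨fun w hw => ?_, fun hδ => ?_⟩
  · have hp1 := hw.sum_integral (D := D)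
    have hp0 := hw.integral_nonneg (D := D)
    set p := fun m => ∫ z, w m z.1 ∂D with hp
    have hsum : ∀ {a : Fin M → ℝ} {B : ℝ}, (∀ m, |a m| ≤ B) → |∑ m, p m * a m| ≤ B :=
      fun {a B} ha => by
        refine (Finset.abs_sum_le_sum_abs _ _).trans ?_
        calc
          _ ≤ ∑ m, p m * B := Finset.sum_le_sum fun m _ => by
            rw [abs_mul, abs_of_nonneg (hp0 m)]
            exact mul_le_mul_of_nonneg_left (ha m) (hp0 m)
          _ = B := by rw [← Finset.sum_mul, hp1, one_mul]
    have hΨm : Measurable fun S => ∑ m, p m * Φ m S :=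
      Finset.measurable_sum _ fun m _ => (hΦm m).const_mul _
    -- Weights summing to 1 exclude `M = 0`, so the single `ε` obtained here is at most `M * ε`.
    have hM : (1 : ℝ) ≤ M := by
      rcases Nat.eq_zero_or_pos M with rfl | h
      · simp at hp1
      · exact_mod_cast h
    have htail := measureReal_add_le_of_bounded_differences D hN (fun S => ∑ m, p m * Φ m S) hΨm
      (fun S => hsum fun m => hΦb m S) (fun i S S' h => by
        rw [← Finset.sum_sub_distrib]
        simp only [← mul_sub]
        exact hsum fun m => hΦd m i S S' h) hε0
    have hexp := exp_neg_mul_sqrt_log hN hδ0 hδ1 1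
    simp only [Nat.cast_one, one_mul, one_pow, pow_one] at hexp
    refine holdsWithProb_of_compl (measurableSet_le measurable_const hΨm) (htail.trans_eq hexp)
      fun S hS f hf => key w hw f hf S ?_
    rw [Set.mem_ofPred_eq, not_le, integral_finsetSum _ fun m _ => (hΦi m).const_mul _] at hS
    simp only [integral_const_mul] at hS
    nlinarith [hmean w hw]
  -- The exceptional set is chosen before the weights; off it, any average of the `Φ m` exceeds the
  -- same average of their means by at most `M * ε`.
  · refine holdsWithProb_of_compl (C := ⋃ m, {S | ∫ S, Φ m S ∂P + M * ε ≤ Φ m S})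
      (MeasurableSet.iUnion fun m => measurableSet_le measurable_const (hΦm m)) ?_
      fun S hS w hw f hf => key w hw f hf S ?_
    · refine (measureReal_iUnion_fintype_le _).trans ?_
      refine (Finset.sum_le_sum fun m _ => (measureReal_add_le_of_bounded_differences D hN (Φ m)
        (hΦm m) (hΦb m) (hΦd m) (by positivity)).trans_eq
          (exp_neg_mul_sqrt_log hN hδ0 hδ1 M)).trans ?_
      simpa using nat_mul_pow_sq_le hδ0 hδ M
    · simp only [Set.mem_iUnion, Set.mem_ofPred_eq, not_exists, not_le] at hS
      calc
        _ ≤ ∑ m, (∫ z, w m z.1 ∂D) * (∫ S, Φ m S ∂P + M * ε) := Finset.sum_le_sum fun m _ =>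
          mul_le_mul_of_nonneg_left (hS m).le (hw.integral_nonneg m)
        _ = ∑ m, (∫ z, w m z.1 ∂D) * ∫ S, Φ m S ∂P + M * ε := by
          simp only [mul_add, Finset.sum_add_distrib, ← Finset.sum_mul, hw.sum_integral, one_mul]
        _ ≤ _ := by linarith [hmean w hw]

end Model

end Fusion

end

theorem mainTheorem1 {M : ℕ} {X : Fin M → Type*} {Y : Type*}
    [∀ m, MeasurableSpace (X m)] [MeasurableSpace Y]
    (D : Measure ((∀ m, X m) × Y)) [IsProbabilityMeasure D]
    (A : Set ℝ) (ℓ : ℝ → Y → ℝ)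
    (hℓ_meas : Measurable (Function.uncurry ℓ))
    (hℓ_convex : ∀ y, ConvexOn ℝ A (fun a => ℓ a y))
    (hℓ_range : ∀ a ∈ A, ∀ y, ℓ a y ∈ Set.Icc (0 : ℝ) 1)
    (F : ∀ m, Set (X m → ℝ))
    (hF_meas : ∀ m, ∀ g ∈ F m, Measurable g)
    (hF_range : ∀ m, ∀ g ∈ F m, ∀ x, g x ∈ A)
    (hF_sep : ∀ m, Fusion.PointwiseSeparable (Fusion.lossClass ℓ m (F m)))
    (N : ℕ) (hN : 0 < N) (δ : ℝ) (hδ0 : 0 < δ) (hδ1 : δ < 1) :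
    -- general loss, with twice the Rademacher complexity of the loss class
    ((∀ w, Fusion.IsWeights w →
        Fusion.HoldsWithProb (Measure.pi fun _ : Fin N => D) (1 - δ) fun S =>
          ∀ f, (∀ m, f m ∈ F m) → Fusion.genError D ℓ w f ≤
            Fusion.fusionBound D ℓ
              (fun m => 2 * Fusion.rademacher D N (Fusion.lossClass ℓ m (F m))) δ w f S) ∧
      (δ ≤ 1 / 2 →
        Fusion.HoldsWithProb (Measure.pi fun _ : Fin N => D) (1 - δ) fun S =>
          ∀ w, Fusion.IsWeights w → ∀ f, (∀ m, f m ∈ F m) → Fusion.genError D ℓ w f ≤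
            Fusion.fusionBound D ℓ
              (fun m => 2 * Fusion.rademacher D N (Fusion.lossClass ℓ m (F m))) δ w f S)) ∧
    -- base learners with values in {-1, 1} and zero-one base losses, with the Rademacher
    -- complexity of the class of base learners itself
    (∀ label : Y → ℝ, (∀ y, label y = 1 ∨ label y = -1) →
      (∀ m, ∀ g ∈ F m, ∀ x, g x = 1 ∨ g x = -1) →
      (∀ a y, a = 1 ∨ a = -1 → ℓ a y = if a = label y then 0 else 1) →
      (∀ w, Fusion.IsWeights w →
        Fusion.HoldsWithProb (Measure.pi fun _ : Fin N => D) (1 - δ) fun S =>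
          ∀ f, (∀ m, f m ∈ F m) → Fusion.genError D ℓ w f ≤
            Fusion.fusionBound D ℓ
              (fun m => Fusion.rademacher D N (Fusion.learnerClass Y m (F m))) δ w f S) ∧
      (δ ≤ 1 / 2 →
        Fusion.HoldsWithProb (Measure.pi fun _ : Fin N => D) (1 - δ) fun S =>
          ∀ w, Fusion.IsWeights w → ∀ f, (∀ m, f m ∈ F m) → Fusion.genError D ℓ w f ≤
            Fusion.fusionBound D ℓ
              (fun m => Fusion.rademacher D N (Fusion.learnerClass Y m (F m))) δ w f S)) := by
  refine ⟨Fusion.holdsWithProb_genError_le D A ℓ hℓ_meas hℓ_convex hℓ_range F hF_meas hF_range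
    hF_sep hN hδ0 hδ1 _ fun m _ => le_rfl, fun label hlabel hF hℓ => ?_⟩
  exact Fusion.holdsWithProb_genError_le D A ℓ hℓ_meas hℓ_convex hℓ_range F hF_meas hF_range
    hF_sep hN hδ0 hδ1 _ fun m hne =>
      (Fusion.two_mul_rademacher_lossClass D N hlabel hne (hF m) hℓ).le
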